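/- Let $I$ be an instance of the fair allocation problem with a finite set $N$ of $n \ge 1$ agents, a finite set $M$ of $m$ goods, and for every agent $i$ an additive valuation $v_i : 2^M \to \mathbb{R}$, i.e. $v_i(S) = \sum_{g \in S} v_i(\{g\})$ for all $S \subseteq M$, with $v_i(\{g\}) \ge 0$ for every $g \in M$. An allocation is a partition $A = \langle A_j \rangle_{j \in N}$ of $M$ into $n$ (possibly empty) bundles, one for each agent. The maximin share of agent $i$ is $\mu_i = \max_{A} \min_{j \in N} v_i(A_j)$, where $A$ ranges over all allocations, and an MMS allocation is an allocation $A$ with $v_i(A_i) \ge \mu_i$ for every agent $i$. **Theorem.** For every integer $c > 0$ there exists an integer $n_c \ge 0$ with $n_c \le \lfloor 0.6597^c \cdot c! \rfloor$ such that every such instance with $n \ge \max(n_c, 1)$ agents and at most $n + c$ goods has an MMS allocation. -/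

import Mathlib

/-- An instance of the fair allocation problem with agents `N`, items `M` and one additive valuation
function per agent on the sets of items, in which every item is a good (has non-negative value). -/
structure GoodsInstance (N M : Type*) where
  /-- `v i S` is the value of the set of goods `S` for agent `i`. -/
  v : N → Finset M → ℝ
  additive : ∀ (i : N) (S : Finset M), v i S = ∑ g ∈ S, v i {g}
  nonneg : ∀ (i : N) (g : M), 0 ≤ v i {g}

/-- An allocation: a partition of the goods into bundles, one (possibly empty) bundle for each agent.
It is given by the map that sends each good to the agent who receives it. -/
abbrev Allocation (N M : Type*) := M → N

/-- The bundle that agent `i` receives. -/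
def Allocation.bundle {N M : Type*} [DecidableEq N] [Fintype M]
    (A : Allocation N M) (i : N) : Finset M :=
  Finset.univ.filter fun g => A g = i

namespace GoodsInstance

variable {N M : Type*} [Fintype N] [Nonempty N] [DecidableEq N] [Fintype M] [DecidableEq M]

/-- The maximin share of agent `i`: the maximum over all allocations of the minimum over all bundles
of the value of the bundle for `i`. -/
noncomputable def mms (I : GoodsInstance N M) (i : N) : ℝ :=
  (Finset.univ : Finset (Allocation N M)).sup' Finset.univ_nonempty fun A =>
    (Finset.univ : Finset N).inf' Finset.univ_nonempty fun j => I.v i (A.bundle j)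

/-- `A` is an MMS allocation: every agent gets a bundle worth at least her maximin share. -/
def IsMMSAllocation (I : GoodsInstance N M) (A : Allocation N M) : Prop :=
  ∀ i : N, I.mms i ≤ I.v i (A.bundle i)

end GoodsInstance

namespace MaximinShare

open Finset

/-! Only instances in which all agents rank the goods alike need be served
(`exists_isMMSAllocation_of_served`): an allocation of ranks becomes one of real goods by letting
the agents pick in turn. Goods are then natural numbers, smaller being better.

The core statement, `Serves`, allows spare agents: from `V e + k` agents who can each split `k + e`
goods into `k` good bundles, some `k` can be served. It is proved by induction on `k`, each step
handing one bundle to one agent so that enough others can still split the rest into `k - 1` bundles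
(`Serves.succ`). If some agent has a bundle with at most one good, the best good is handed out. If
some pair comes late enough in the order, it costs everyone else at most one bundle
(`HasShare.sdiff_pair`). Otherwise the agents are classified by a bundle with one good left open; in
a class that is large enough, the member whose open good is worst can be served, since the others
prefer their own (`Serves.step_class`). If every class were small, the number of agents would be at
most `pairBound` and at most `worstBound`, so `V` only has to exceed one of these.

No agent is spare in the theorem. For `c ≤ 4` none is needed, as `spareAgents c = 0`. For larger
`c`, while there are more bundles than surplus goods every agent has a bundle of at most one good,
so any agent is content with the best good. The recipients of these goods may be chosen last; hence
all `n` agents compete for the last `c` bundles (`Serves.of_le`), and `spareAgents c + c ≤ n`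
suffices. -/

/-- `G` can be split into `k` bundles each worth at least `a`. -/
def HasShare (v : ℕ → ℝ) (a : ℝ) (G : Finset ℕ) (k : ℕ) : Prop :=
  ∃ f : ℕ → ℕ, ∀ j < k, a ≤ ∑ g ∈ G with f g = j, v g

/-- The goods of `G` can be distributed so that each agent of `T` receives her target value. -/
def Served {ι : Type*} [DecidableEq ι] (v : ι → ℕ → ℝ) (a : ι → ℝ) (T : Finset ι)
    (G : Finset ℕ) : Prop :=
  ∃ F : ℕ → ι, ∀ i ∈ T, a i ≤ ∑ g ∈ G with F g = i, v i g

/-! ### Splittings of one agent under removal and exchange of goods -/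

section HasShare

variable {v : ℕ → ℝ} {a : ℝ} {G H B : Finset ℕ} {k : ℕ}

lemma HasShare.mono (hv : ∀ g, 0 ≤ v g) (h : HasShare v a G k) (hGH : G ⊆ H) :
    HasShare v a H k := by
  obtain ⟨f, hf⟩ := h
  exact ⟨f, fun j hj => (hf j hj).trans
    (sum_le_sum_of_subset_of_nonneg (filter_subset_filter _ hGH) fun g _ _ => hv g)⟩

/-- The better good `p` takes the place of `x` in the bundle of `x`, and no bundle loses value. -/
lemma HasShare.replace (hanti : Antitone v) (h : HasShare v a G k) {x p : ℕ} (hx : x ∈ G)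
    (hp : p ∉ G) (hpx : p ≤ x) : HasShare v a (insert p (G.erase x)) k := by
  obtain ⟨f, hf⟩ := h
  refine ⟨Function.update f p (f x), fun j hj => (hf j hj).trans ?_⟩
  have hp' : p ∉ G.erase x := fun h => hp (mem_of_mem_erase h)
  have key : ∑ g ∈ G.erase x, (if Function.update f p (f x) g = j then v g else 0)
      = ∑ g ∈ G.erase x, if f g = j then v g else 0 := by
    refine sum_congr rfl fun g hg => ?_
    rw [Function.update_of_ne]
    rintro rfl
    exact hp' hg
  rw [sum_filter, sum_filter, sum_insert hp', key, ← add_sum_erase _ _ hx]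
  have := hanti hpx
  simp only [Function.update_self]
  split_ifs <;> linarith

lemma HasShare.exchange (hanti : Antitone v) (h : HasShare v a (G \ B) k) {x p : ℕ}
    (hp : p ∈ B) (hpG : p ∈ G) (hx : x ∈ G) (hxB : x ∉ B) (hpx : p ≤ x) :
    HasShare v a (G \ insert x (B.erase p)) k := by
  convert h.replace hanti (x := x) (p := p) (by simp [hx, hxB]) (by simp [hp]) hpx using 1
  ext g
  simp only [mem_sdiff, mem_insert, mem_erase]
  grind

lemma hasShare_filter_ne {f : ℕ → ℕ} (hf : ∀ j < k + 1, a ≤ ∑ g ∈ G with f g = j, v g)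
    {i : ℕ} (hi : i < k + 1) : HasShare v a (G.filter fun g => f g ≠ i) k := by
  refine ⟨fun g => Equiv.swap i k (f g), fun j hj => ?_⟩
  have hne : Equiv.swap i k j ≠ i := by
    intro h
    have := congrArg (Equiv.swap i k) h
    rw [Equiv.swap_apply_self, Equiv.swap_apply_left] at this
    omega
  have hlt : Equiv.swap i k j < k + 1 := by
    rw [Equiv.swap_apply_def]
    split_ifs <;> omega
  refine (hf _ hlt).trans (le_of_eq (sum_congr ?_ fun _ _ => rfl))
  ext g
  simp only [mem_filter]
  constructor
  · rintro ⟨hg, h⟩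
    refine ⟨⟨hg, h ▸ hne⟩, ?_⟩
    rw [h, Equiv.swap_apply_self]
  · rintro ⟨⟨hg, -⟩, h⟩
    exact ⟨hg, by rw [← h, Equiv.swap_apply_self]⟩

lemma HasShare.exists_lt (hv : ∀ g, 0 ≤ v g) (h : HasShare v a G (k + 1)) :
    ∃ f : ℕ → ℕ, (∀ g, f g < k + 1) ∧ ∀ j < k + 1, a ≤ ∑ g ∈ G with f g = j, v g := by
  obtain ⟨f, hf⟩ := h
  refine ⟨fun g => if f g < k + 1 then f g else 0, fun g => ?_, fun j hj => (hf j hj).trans ?_⟩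
  · dsimp only
    split_ifs <;> omega
  · refine sum_le_sum_of_subset_of_nonneg (fun g hg => ?_) fun g _ _ => hv g
    rw [mem_filter] at hg ⊢
    refine ⟨hg.1, ?_⟩
    dsimp only
    rw [if_pos (by omega), hg.2]

/-- Only the bundle containing `x` is spoilt; its other goods are discarded. -/
lemma HasShare.erase (hv : ∀ g, 0 ≤ v g) (h : HasShare v a G (k + 1)) (x : ℕ) :
    HasShare v a (G.erase x) k := by
  obtain ⟨f, hlt, hf⟩ := h.exists_lt hv
  refine (hasShare_filter_ne hf (hlt x)).mono hv fun g hg => ?_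
  rw [mem_filter] at hg
  exact mem_erase.2 ⟨fun h => hg.2 (h ▸ rfl), hg.1⟩

/-- Removing two goods that come after sufficiently many others costs only one bundle. -/
lemma HasShare.sdiff_pair (hv : ∀ g, 0 ≤ v g) (hanti : Antitone v)
    (h : HasShare v a G (k + 1)) {x y : ℕ} (hx : x ∈ G) (hy : y ∈ G) (hxy : x < y)
    (hcard : k + 1 ≤ (G.filter (· ≤ x)).card) : HasShare v a (G \ {x, y}) k := by
  obtain ⟨f, hlt, hf⟩ := h.exists_lt hv
  -- Pigeonhole: `y` and the goods up to `x` are at least `k + 2` goods in `k + 1` bundles, so two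
  -- of them, `p < q`, share a bundle. That bundle is given up, and `p ≤ x`, `q ≤ y` allow
  -- exchanging `{p, q}` for `{x, y}`.
  have hyn : y ∉ G.filter (· ≤ x) := by simp [hxy]
  obtain ⟨p, hp, q, hq, hpq, hfpq⟩ :=
    exists_ne_map_eq_of_card_lt_of_maps_to (s := insert y (G.filter (· ≤ x)))
      (t := range (k + 1)) (f := f) (by rw [card_insert_of_notMem hyn, card_range]; omega)
      (fun g _ => by simpa using hlt g)
  wlog hlt' : p < q generalizing p q
  · exact this q hq p hp hpq.symm hfpq.symm (by omega)
  simp only [mem_insert, mem_filter] at hp hq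
  have hpG : p ∈ G := by rcases hp with rfl | hp <;> [exact hy; exact hp.1]
  have hqG : q ∈ G := by rcases hq with rfl | hq <;> [exact hy; exact hq.1]
  have h0 : HasShare v a (G \ {p, q}) k := by
    refine (hasShare_filter_ne hf (hlt p)).mono hv fun g hg => ?_
    rw [mem_filter] at hg
    simp only [mem_sdiff, mem_insert, mem_singleton]
    refine ⟨hg.1, ?_⟩
    rintro (rfl | rfl)
    · exact hg.2 rfl
    · exact hg.2 hfpq.symm
  have hpx : p ≤ x := by omega
  by_cases hqy : q = y
  · subst hqy
    by_cases hpx' : p = x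
    · rwa [hpx'] at h0
    · convert h0.exchange hanti (x := x) (p := p) (by simp) hpG hx (by simp; omega) hpx using 2
      ext g; simp; omega
  · have hqx : q ≤ x := by omega
    by_cases hqx' : q = x
    · subst hqx'
      convert h0.exchange hanti (x := y) (p := p) (by simp) hpG hy (by simp; omega)
        (by omega) using 2
      ext g; simp; omega
    · have h1 := h0.exchange hanti (x := x) (p := p) (by simp) hpG hx (by simp; omega) hpx
      have h2 := h1.exchange hanti (x := y) (p := q) (by simp; omega) hqG hy (by simp; omega)
        (by omega)
      convert h2 using 2
      ext g; simp; omega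

end HasShare

/-! ### Serving several agents at once -/

section Served

variable {ι : Type*} [DecidableEq ι] {v : ι → ℕ → ℝ} {a : ι → ℝ} {T : Finset ι}
  {G B : Finset ℕ} {i : ι}

lemma Served.insert (hv : ∀ i g, 0 ≤ v i g) (h : Served v a T (G \ B)) (hB : B ⊆ G)
    (hi : i ∉ T) (hiB : a i ≤ ∑ g ∈ B, v i g) : Served v a (insert i T) G := by
  obtain ⟨F, hF⟩ := h
  refine ⟨fun g => if g ∈ B then i else F g, fun j hj => ?_⟩
  rcases mem_insert.1 hj with rfl | hjT
  · refine hiB.trans (sum_le_sum_of_subset_of_nonneg (fun g hg => ?_) fun g _ _ => hv _ g)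
    simp [hB hg, hg]
  · refine (hF j hjT).trans (sum_le_sum_of_subset_of_nonneg (fun g hg => ?_) fun g _ _ => hv _ g)
    simp only [mem_filter, mem_sdiff] at hg ⊢
    exact ⟨hg.1.1, by rw [if_neg hg.1.2]; exact hg.2⟩

lemma served_singleton (h : a i ≤ ∑ g ∈ G, v i g) : Served v a {i} G :=
  ⟨fun _ => i, fun j hj => by rw [mem_singleton.1 hj]; simpa using h⟩

/-- Cut and choose: `i` cuts and `i'` takes a half. One half is good enough for `i'`, because her
total value is at least `2 * a i'`. -/
lemma served_pair (hv : ∀ i g, 0 ≤ v i g) {i' : ι} (hne : i ≠ i') (hi : HasShare (v i) (a i) G 2)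
    (hi' : HasShare (v i') (a i') G 2) : Served v a {i, i'} G := by
  obtain ⟨f, hlt, hf⟩ := hi.exists_lt (hv i)
  obtain ⟨f', hlt', hf'⟩ := hi'.exists_lt (hv i')
  have split : ∀ f : ℕ → ℕ, (∀ g, f g < 2) → ∀ w : ℕ → ℝ, ∑ g ∈ G, w g
      = ∑ g ∈ G with f g = 0, w g + ∑ g ∈ G with f g = 1, w g := by
    intro f hf w
    rw [← sum_filter_add_sum_filter_not G (fun g => f g = 0)]
    congr 2
    refine filter_congr fun g _ => ?_
    have := hf g
    omega
  have hcompl : ∀ j < 2, G \ G.filter (fun g => f g = j) = G.filter fun g => f g = 1 - j := by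
    intro j hj
    ext g
    have := hlt g
    simp only [mem_sdiff, mem_filter]
    constructor
    · rintro ⟨h1, h2⟩
      exact ⟨h1, by have : f g ≠ j := fun h => h2 ⟨h1, h⟩
                    omega⟩
    · rintro ⟨h1, h2⟩
      exact ⟨h1, fun h => by omega⟩
  have key : ∃ j < 2, a i' ≤ ∑ g ∈ G with f g = j, v i' g := by
    by_contra! hcon
    have h1 := split f hlt (v i')
    have h2 := split f' hlt' (v i')
    linarith [hcon 0 (by norm_num), hcon 1 (by norm_num), hf' 0 (by norm_num),
      hf' 1 (by norm_num)]
  obtain ⟨j, hj, hji⟩ := key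
  rw [pair_comm]
  refine Served.insert hv (B := G.filter fun g => f g = j) ?_ (filter_subset _ _)
    (by simpa using hne.symm) hji
  rw [hcompl j hj]
  exact served_singleton (hf _ (by omega))

end Served

/-! ### The induction on the number of bundles -/

section Core

variable {ι : Type*} [DecidableEq ι] {v : ι → ℕ → ℝ} {a : ι → ℝ}

/-- Whenever `V e + k` agents can each split `k + e` goods into `k` satisfactory bundles, some `k`
of them can be served. -/
def Serves (v : ι → ℕ → ℝ) (a : ι → ℝ) (V : ℕ → ℕ) (k e : ℕ) : Prop :=
  ∀ (G : Finset ℕ) (S : Finset ι), G.card = k + e → V e + k ≤ S.card →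
    (∀ i ∈ S, HasShare (v i) (a i) G k) → ∃ T ⊆ S, T.card = k ∧ Served v a T G

/-- Serving one agent with `B` and the others from the remaining goods. -/
lemma Serves.step (hv : ∀ i g, 0 ≤ v i g) {V : ℕ → ℕ} {k e : ℕ} (h : Serves v a V k e)
    {G B : Finset ℕ} {S S' : Finset ι} {i : ι} (hi : i ∈ S) (hB : B ⊆ G)
    (hiB : a i ≤ ∑ g ∈ B, v i g) (hS' : S' ⊆ S.erase i) (hG : G.card = k + e + B.card)
    (hcard : V e + k ≤ S'.card) (hshare : ∀ j ∈ S', HasShare (v j) (a j) (G \ B) k) :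
    ∃ T ⊆ S, T.card = k + 1 ∧ Served v a T G := by
  obtain ⟨T, hT, hTk, hserved⟩ := h (G \ B) S'
    (by rw [card_sdiff_of_subset hB]; omega) hcard hshare
  have hiT : i ∉ T := fun h => by simpa using hS' (hT h)
  exact ⟨insert i T, insert_subset hi (hT.trans (hS'.trans (erase_subset _ _))),
    by rw [card_insert_of_notMem hiT, hTk], hserved.insert hv hB hiT hiB⟩

/-- Agents whose bundles differ only in one good: the worst bundle can be handed out. -/
lemma Serves.step_class (hv : ∀ i g, 0 ≤ v i g) (hanti : ∀ i, Antitone (v i)) {V : ℕ → ℕ}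
    {k e : ℕ} (h : Serves v a V k e) {G R : Finset ℕ} {S S' : Finset ι} (hS' : S' ⊆ S)
    (hG : G.card = k + e + R.card + 1) (hcard : V e + k < S'.card)
    (hR : ∀ i ∈ S', ∃ y ∈ G, y ∉ R ∧ R ⊆ G ∧ a i ≤ ∑ g ∈ insert y R, v i g ∧
      HasShare (v i) (a i) (G \ insert y R) k) :
    ∃ T ⊆ S, T.card = k + 1 ∧ Served v a T G := by
  choose! y hyG hyR hRG hya hyS using hR
  -- The agent with the worst open good is served. Any other member `j` of the class gets back her
  -- own `y j`, which is at least as good, in exchange for `y i`.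
  obtain ⟨i, hi, hmax⟩ := exists_max_image S' y (card_pos.1 (by omega))
  refine h.step hv (hS' hi) (B := insert (y i) R) (S' := S'.erase i)
    (insert_subset (hyG i hi) (hRG i hi)) (hya i hi) (erase_subset_erase _ hS')
    (by rw [card_insert_of_notMem (hyR i hi)]; omega) (by rw [card_erase_of_mem hi]; omega)
    fun j hj => ?_
  have hjS := mem_of_mem_erase hj
  by_cases heq : y j = y i
  · rw [← heq]
    exact hyS j hjS
  · have := (hyS j hjS).exchange (hanti j) (x := y i) (p := y j) (mem_insert_self _ _)
      (hyG j hjS) (hyG i hi) (by simp [hyR i hi, Ne.symm heq]) (hmax j hjS)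
    rwa [erase_insert (hyR j hjS)] at this

/-- The number of agents covered by bundles that contain a pair, plus those without one. -/
def pairBound (V : ℕ → ℕ) (k e : ℕ) : ℕ :=
  -- The better good of a suitable pair has a rank from `max 1 (2 * k - e)` to `k - 1`, which leaves
  -- at most `min (k - 1) (e - k)` classes.
  min (k - 1) (e - k) * (V (e - 1) + (k - 1)) +
    -- Without pairs, every bundle has at least three goods. If the one with the worst good has `t +
    -- 2`, then `t + 2 + 3 * (k - 1) ≤ k + e`. Its open good is the best in the bundle, so the `t`
    -- free goods avoid both the best and the worst of all `k + e` goods.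
    ∑ t ∈ Icc 1 (e + 1 - 2 * k), (k + e - 2).choose t * (V (e - 1 - t) + (k - 1))

/-- The number of agents covered by bundles containing the worst good. -/
def worstBound (V : ℕ → ℕ) (k e : ℕ) : ℕ :=
  ∑ t ∈ range (e - k + 1), (k + e - 2).choose t * (V (e - 1 - t) + (k - 1))

lemma card_bundle_add_le {k n c j : ℕ} {b : ℕ → ℕ} (hsum : ∑ j ∈ range k, b j = n)
    (hb : ∀ j < k, c ≤ b j) (hj : j < k) : b j + c * (k - 1) ≤ n := by
  rw [← hsum, ← add_sum_erase _ _ (mem_range.2 hj)]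
  have := card_nsmul_le_sum ((range k).erase j) b c fun x hx =>
    hb x (mem_range.1 (mem_of_mem_erase hx))
  rw [card_erase_of_mem (mem_range.2 hj), card_range, smul_eq_mul, mul_comm] at this
  exact Nat.add_le_add_left this (b j)

lemma card_filter_rank_le (G : Finset ℕ) (l u : ℕ) :
    (G.filter fun x => l ≤ (G.filter (· ≤ x)).card ∧ (G.filter (· ≤ x)).card ≤ u).card
      ≤ u + 1 - l := by
  rw [← Nat.card_Icc]
  refine card_le_card_of_injOn (fun x => (G.filter (· ≤ x)).card) (fun x hx => ?_) ?_
  · simpa using (mem_filter.1 hx).2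
  · have key : ∀ x ∈ G, ∀ y ∈ G, x < y → (G.filter (· ≤ x)).card < (G.filter (· ≤ y)).card := by
      intro x _ y hy hxy
      refine card_lt_card ⟨fun g hg => ?_, fun h => ?_⟩
      · rw [mem_filter] at hg ⊢
        exact ⟨hg.1, by omega⟩
      · have := h (mem_filter.2 ⟨hy, le_rfl⟩)
        rw [mem_filter] at this
        omega
    intro x hx y hy hxy
    have hx' := (mem_filter.1 hx).1
    have hy' := (mem_filter.1 hy).1
    by_contra hne
    rcases lt_or_gt_of_ne hne with h | h
    · exact (key x hx' y hy' h).ne hxy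
    · exact (key y hy' x hx' h).ne' hxy

/-- If most bundles have exactly two goods, some pair has many goods in front of it. -/
lemma exists_pair_with_large_rank {G : Finset ℕ} {f : ℕ → ℕ} {k e : ℕ}
    (hsum : ∑ j ∈ range k, (G.filter fun g => f g = j).card = k + e)
    (htwo : ∀ j < k, 2 ≤ (G.filter fun g => f g = j).card)
    (hex : ∃ j < k, (G.filter fun g => f g = j).card = 2) :
    ∃ j < k, ∃ x y, x < y ∧ (G.filter fun g => f g = j) = {x, y} ∧
      max 1 (2 * k - e) ≤ (G.filter (· ≤ x)).card := by
  set b : ℕ → Finset ℕ := fun j => G.filter fun g => f g = j with hb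
  set P := (range k).filter fun j => (b j).card = 2 with hP
  have hpair : ∀ j ∈ P, ∃ x y, x < y ∧ b j = {x, y} := by
    intro j hj
    obtain ⟨x, y, hne, h⟩ := card_eq_two.1 (mem_filter.1 hj).2
    rcases lt_or_gt_of_ne hne with hlt | hlt
    · exact ⟨x, y, hlt, h⟩
    · exact ⟨y, x, hlt, by rw [h, pair_comm]⟩
  choose! x y hxy hbxy using hpair
  have hPne : P.Nonempty := by
    obtain ⟨j, hj, h⟩ := hex
    exact ⟨j, mem_filter.2 ⟨mem_range.2 hj, h⟩⟩
  have hPcard : 2 * k - e ≤ P.card := by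
    -- Adding one to the size of each pair makes every bundle count at least three, so `3 * k ≤ k +
    -- e + P.card`.
    have h3 : ∑ j ∈ range k, 3 ≤ ∑ j ∈ range k, ((b j).card + if (b j).card = 2 then 1 else 0) := by
      refine sum_le_sum fun j hj => ?_
      have := htwo j (mem_range.1 hj)
      change 2 ≤ (b j).card at this
      split_ifs <;> omega
    rw [sum_add_distrib, hsum, ← card_filter, sum_const, card_range, smul_eq_mul, ← hP] at h3
    omega
  have hxb : ∀ j ∈ P, x j ∈ G ∧ f (x j) = j := by
    intro j hj
    have : x j ∈ b j := by rw [hbxy j hj]; simp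
    exact mem_filter.1 this
  obtain ⟨j, hj, hmax⟩ := exists_max_image P x hPne
  refine ⟨j, mem_range.1 (mem_filter.1 hj).1, x j, y j, hxy j hj, hbxy j hj, ?_⟩
  -- The better goods of the pairs are distinct, and none comes after `x j`, the last of them.
  have hle : P.card ≤ (G.filter (· ≤ x j)).card := by
    refine card_le_card_of_injOn x (fun l hl => ?_) fun l hl l' hl' h => ?_
    · simpa using ⟨(hxb l hl).1, hmax l hl⟩
    · rw [← (hxb l hl).2, ← (hxb l' hl').2, h]
  have := hPne.card_pos
  omega

lemma serves_one (hv : ∀ i g, 0 ≤ v i g) (V : ℕ → ℕ) (e : ℕ) : Serves v a V 1 e := by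
  intro G S _ hS hshare
  obtain ⟨i, hi⟩ := card_pos.1 (show 0 < S.card by omega)
  obtain ⟨f, hf⟩ := hshare i hi
  exact ⟨{i}, by simpa using hi, rfl, served_singleton ((hf 0 one_pos).trans
    (sum_le_sum_of_subset_of_nonneg (filter_subset _ _) fun g _ _ => hv i g))⟩

lemma serves_two (hv : ∀ i g, 0 ≤ v i g) (V : ℕ → ℕ) (e : ℕ) : Serves v a V 2 e := by
  intro G S _ hS hshare
  obtain ⟨i, hi, i', hi', hne⟩ := one_lt_card.1 (show 1 < S.card by omega)
  exact ⟨{i, i'}, by simp [insert_subset_iff, hi, hi'], card_pair hne,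
    served_pair hv hne (hshare i hi) (hshare i' hi')⟩

/-- Agents whose partition has a bundle with at most one good can be given the best good. -/
lemma Serves.step_top (hv : ∀ i g, 0 ≤ v i g) (hanti : ∀ i, Antitone (v i)) {V : ℕ → ℕ}
    {k e : ℕ} (h : Serves v a V k e) {G : Finset ℕ} {S : Finset ι} (hG : G.card = k + 1 + e)
    (hS : V e + (k + 1) ≤ S.card) (hshare : ∀ i ∈ S, HasShare (v i) (a i) G (k + 1)) {i : ι}
    (hi : i ∈ S) {B : Finset ℕ} (hBG : B ⊆ G) (hB : B.card ≤ 1) (hiB : a i ≤ ∑ g ∈ B, v i g) :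
    ∃ T ⊆ S, T.card = k + 1 ∧ Served v a T G := by
  have hne : G.Nonempty := card_pos.1 (by omega)
  refine h.step hv hi (B := {G.min' hne}) (by simpa using G.min'_mem hne) ?_ Subset.rfl
    (by rw [card_singleton]; omega) (by rw [card_erase_of_mem hi]; omega) fun j hj => ?_
  · rw [sum_singleton]
    refine hiB.trans ?_
    rcases Nat.le_one_iff_eq_zero_or_eq_one.1 hB with h0 | h1
    · rw [card_eq_zero.1 h0, sum_empty]
      exact hv _ _
    · obtain ⟨g, rfl⟩ := card_eq_one.1 h1
      rw [sum_singleton]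
      exact hanti i (G.min'_le g (hBG (mem_singleton_self g)))
  · rw [sdiff_singleton_eq_erase]
    exact (hshare j (mem_of_mem_erase hj)).erase (hv j) _

/-- If no class of agents is large enough, the number of agents is at most the sum of the class
sizes. -/
lemma card_le_of_classes {S : Finset ι} {X : Finset ℕ} {I : Finset ℕ} {Y : Finset ℕ} {w : ℕ}
    {C : Finset ℕ → Finset ι} {cap : ℕ → ℕ}
    (hcap : ∀ R, R.card ∈ insert 1 (I.image (· + 1)) → (C R).card ≤ cap R.card) (hw : w ∉ Y)
    (hS : ∀ i ∈ S, (∃ x ∈ X, i ∈ C {x}) ∨ ∃ D ⊆ Y, D.card ∈ I ∧ i ∈ C (insert w D)) :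
    S.card ≤ X.card * cap 1 + ∑ t ∈ I, Y.card.choose t * cap (t + 1) := by
  have hsub : S ⊆ (X.biUnion fun x => C {x}) ∪
      I.biUnion fun t => (Y.powersetCard t).biUnion fun D => C (insert w D) := by
    intro i hi
    simp only [mem_union, mem_biUnion, mem_powersetCard]
    rcases hS i hi with ⟨x, hx, h⟩ | ⟨D, hD, hDI, h⟩
    · exact Or.inl ⟨x, hx, h⟩
    · exact Or.inr ⟨_, hDI, D, ⟨hD, rfl⟩, h⟩
  refine (card_le_card hsub).trans ((card_union_le _ _).trans (add_le_add ?_ ?_))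
  · exact card_biUnion_le_card_mul _ _ _ fun x _ => by
      simpa using hcap {x} (by simp)
  · refine card_biUnion_le.trans (sum_le_sum fun t ht => ?_)
    rw [← card_powersetCard]
    refine card_biUnion_le_card_mul _ _ _ fun D hD => ?_
    rw [mem_powersetCard] at hD
    have hcard : (insert w D).card = t + 1 := by
      rw [card_insert_of_notMem fun h => hw (hD.1 h), hD.2]
    rw [← hcard]
    exact hcap _ (by rw [hcard]; exact mem_insert_of_mem (mem_image_of_mem _ ht))

/-- A bundle of at most one good, or a pair late in the order, can be handed out directly. Failing
both, `hbound` forces some class of agents to be large enough for `Serves.step_class`. -/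
lemma Serves.succ (hv : ∀ i g, 0 ≤ v i g) (hanti : ∀ i, Antitone (v i)) {V : ℕ → ℕ}
    (hV : Monotone V) {k : ℕ} (hk : 2 ≤ k) (ih : ∀ e, Serves v a V k e) {e : ℕ}
    (hbound : k + 1 ≤ e → pairBound V (k + 1) e < V e + (k + 1) ∨
      worstBound V (k + 1) e < V e + (k + 1)) : Serves v a V (k + 1) e := by
  classical
  intro G S hG hS hshare
  have hf : ∀ i, ∃ f : ℕ → ℕ, i ∈ S → (∀ g, f g < k + 1) ∧
      ∀ j < k + 1, a i ≤ ∑ g ∈ G with f g = j, v i g := by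
    intro i
    by_cases hi : i ∈ S
    · obtain ⟨f, h⟩ := (hshare i hi).exists_lt (hv i)
      exact ⟨f, fun _ => h⟩
    · exact ⟨id, fun h => absurd h hi⟩
  choose f hf using hf
  set b : ι → ℕ → Finset ℕ := fun i j => G.filter fun g => f i g = j with hb
  have hbG : ∀ i j, b i j ⊆ G := fun i j => filter_subset _ _
  by_cases hone : ∃ i ∈ S, ∃ j < k + 1, (b i j).card ≤ 1
  · obtain ⟨i, hi, j, hj, hc⟩ := hone
    exact (ih e).step_top hv hanti hG hS hshare hi (hbG i j) hc ((hf i hi).2 j hj)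
  push Not at hone
  have hsum : ∀ i ∈ S, ∑ j ∈ range (k + 1), (b i j).card = k + 1 + e := by
    intro i hi
    rw [← hG]
    exact (card_eq_sum_card_fiberwise fun g _ => by simpa using (hf i hi).1 g).symm
  -- All `k + 1` bundles now have at least two of the `k + 1 + e` goods.
  have hke : k + 1 ≤ e := by
    obtain ⟨i, hi⟩ := card_pos.1 (show 0 < S.card by omega)
    have := card_bundle_add_le (hsum i hi) (fun j hj => hone i hi j hj) (show 0 < k + 1 by omega)
    have := hone i hi 0 (by omega)
    omega
  by_cases hpair : ∃ i ∈ S, ∃ j < k + 1, ∃ x y, x < y ∧ b i j = {x, y} ∧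
      k + 1 ≤ (G.filter (· ≤ x)).card
  · obtain ⟨i, hi, j, hj, x, y, hxy, hbxy, hx⟩ := hpair
    have hsub := hbG i j
    rw [hbxy, insert_subset_iff, singleton_subset_iff] at hsub
    have hVe := hV (Nat.sub_le e 1)
    refine (ih (e - 1)).step hv hi (hbG i j) ((hf i hi).2 j hj) Subset.rfl
      (by rw [hbxy, card_pair hxy.ne]; omega) (by rw [card_erase_of_mem hi]; omega)
      fun l hl => ?_
    rw [hbxy]
    exact (hshare l (mem_of_mem_erase hl)).sdiff_pair (hv l) (hanti l) hsub.1 hsub.2 hxy hx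
  push Not at hpair
  -- From here on every class is small; the contradiction comes from counting the agents of `S`.
  by_contra hcon
  set C : Finset ℕ → Finset ι := fun R => S.filter fun i => ∃ y ∈ G, y ∉ R ∧ R ⊆ G ∧
    a i ≤ ∑ g ∈ insert y R, v i g ∧ HasShare (v i) (a i) (G \ insert y R) k with hC
  have hCcap : ∀ R, 1 ≤ R.card → R.card ≤ e → (C R).card ≤ V (e - R.card) + k := by
    intro R h1 hRe
    by_contra! hlt
    exact hcon ((ih (e - R.card)).step_class hv hanti (S' := C R) (filter_subset _ _) (by omega) hlt
      fun i hi => (mem_filter.1 hi).2)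
  have hmemC : ∀ i ∈ S, ∀ j < k + 1, ∀ y R, y ∉ R → b i j = insert y R → i ∈ C R := by
    intro i hi j hj y R hy hbR
    have hsub := hbG i j
    rw [hbR, insert_subset_iff] at hsub
    have hsh : HasShare (v i) (a i) (G \ b i j) k := by
      refine (hasShare_filter_ne (hf i hi).2 hj).mono (hv i) fun g hg => ?_
      rw [mem_filter] at hg
      exact mem_sdiff.2 ⟨hg.1, fun h => hg.2 (mem_filter.1 h).2⟩
    have hval := (hf i hi).2 j hj
    change a i ≤ ∑ g ∈ b i j, v i g at hval
    rw [hbR] at hval hsh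
    exact mem_filter.2 ⟨hi, y, hsub.1, hy, hsub.2, hval, hsh⟩
  have hne : G.Nonempty := card_pos.1 (by omega)
  set w := G.max' hne with hw
  set Y := (G.erase w).erase (G.min' hne) with hY
  have hlt : G.min' hne < w := G.min'_lt_max'_of_card (by omega)
  have hYcard : Y.card = k + 1 + e - 2 := by
    rw [card_erase_of_mem (mem_erase.2 ⟨hlt.ne, G.min'_mem hne⟩),
      card_erase_of_mem (G.max'_mem hne), hG]
    omega
  have hwY : w ∉ Y := by simp [hY]
  -- every agent belongs to the class given by her bundle with the worst good
  have hworst : ∀ i ∈ S, ∃ D ⊆ Y, D.card + 2 = (b i (f i w)).card ∧ i ∈ C (insert w D) := by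
    intro i hi
    have hj := (hf i hi).1 w
    have h2 := hone i hi _ hj
    have hwb : w ∈ b i (f i w) := mem_filter.2 ⟨G.max'_mem hne, rfl⟩
    have hbw : ((b i (f i w)).erase w).Nonempty :=
      card_pos.1 (by rw [card_erase_of_mem hwb]; omega)
    -- Leaving open the best good of the bundle keeps the best good of `G` out of `D`.
    set y := ((b i (f i w)).erase w).min' hbw with hy
    have hyb := min'_mem _ hbw
    rw [← hy] at hyb
    refine ⟨((b i (f i w)).erase w).erase y, fun g hg => ?_, ?_, ?_⟩
    · have hg' := mem_of_mem_erase hg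
      have hgG := hbG i _ (mem_of_mem_erase hg')
      refine mem_erase.2 ⟨?_, mem_erase.2 ⟨(mem_erase.1 hg').1, hgG⟩⟩
      intro hgm
      have h3 := min'_le _ g hg'
      rw [← hy] at h3
      have h4 := G.min'_le y (hbG i _ (mem_of_mem_erase hyb))
      exact (mem_erase.1 hg).1 (by omega)
    · rw [card_erase_of_mem hyb, card_erase_of_mem hwb]
      omega
    · refine hmemC i hi _ hj y _ ?_ ?_
      · simp [(mem_erase.1 hyb).1]
      · rw [insert_comm, insert_erase hyb, insert_erase hwb]
  rcases hbound hke with hbd | hbd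
  · set X := G.filter fun x => max 1 (2 * (k + 1) - e) ≤ (G.filter (· ≤ x)).card ∧
      (G.filter (· ≤ x)).card ≤ k with hX
    have hXcard : X.card ≤ min k (e - (k + 1)) :=
      (card_filter_rank_le G _ _).trans (by omega)
    have := card_le_of_classes (S := S) (X := X) (I := Icc 1 (e + 1 - 2 * (k + 1))) (C := C)
      (cap := fun r => V (e - r) + k) (fun R hR => hCcap R ?_ ?_) hwY ?_
    · rw [hYcard] at this
      have h2 := Nat.mul_le_mul_right (V (e - 1) + k) hXcard
      simp only [pairBound, Nat.add_sub_cancel, Nat.sub_sub, Nat.add_comm 1] at hbd this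
      omega
    · simp only [mem_insert, mem_image, mem_Icc] at hR
      omega
    · simp only [mem_insert, mem_image, mem_Icc] at hR
      omega
    · intro i hi
      by_cases hex : ∃ j < k + 1, (b i j).card = 2
      · obtain ⟨j, hj, x, y, hxy, hbxy, hrank⟩ :=
          exists_pair_with_large_rank (hsum i hi) (hone i hi) hex
        have hxG : x ∈ G := hbG i j (by change b i j = _ at hbxy; rw [hbxy]; simp)
        refine Or.inl ⟨x, mem_filter.2 ⟨hxG, hrank, ?_⟩, ?_⟩
        · have := hpair i hi j hj x y hxy hbxy
          omega
        · exact hmemC i hi j hj y {x} (by simp [hxy.ne']) (hbxy.trans (pair_comm _ _))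
      · push Not at hex
        obtain ⟨D, hD, hDcard, hDC⟩ := hworst i hi
        refine Or.inr ⟨D, hD, ?_, hDC⟩
        have h3 : ∀ j < k + 1, 3 ≤ (b i j).card := fun j hj => by
          have := hone i hi j hj
          have := hex j hj
          omega
        have hj := (hf i hi).1 w
        have := card_bundle_add_le (hsum i hi) h3 hj
        have := h3 _ hj
        rw [mem_Icc]
        omega
  · have := card_le_of_classes (S := S) (X := ∅) (I := range (e - (k + 1) + 1)) (C := C)
      (cap := fun r => V (e - r) + k) (fun R hR => hCcap R ?_ ?_) hwY ?_
    · rw [hYcard] at this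
      simp only [worstBound, Nat.add_sub_cancel, Nat.sub_sub, Nat.add_comm 1, card_empty,
        zero_mul, zero_add] at hbd this
      omega
    · simp only [mem_insert, mem_image, mem_range] at hR
      omega
    · simp only [mem_insert, mem_image, mem_range] at hR
      omega
    · intro i hi
      obtain ⟨D, hD, hDcard, hDC⟩ := hworst i hi
      refine Or.inr ⟨D, hD, ?_, hDC⟩
      have := card_bundle_add_le (hsum i hi) (fun j hj => hone i hi j hj) ((hf i hi).1 w)
      rw [mem_range]
      omega

theorem serves (hv : ∀ i g, 0 ≤ v i g) (hanti : ∀ i, Antitone (v i)) {V : ℕ → ℕ}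
    (hV : Monotone V) (hbound : ∀ k e, 3 ≤ k → k ≤ e →
      pairBound V k e < V e + k ∨ worstBound V k e < V e + k) {k : ℕ} (hk : 1 ≤ k) :
    ∀ e, Serves v a V k e := by
  induction k, hk using Nat.le_induction with
  | base => exact serves_one hv V
  | succ k hk ih =>
    intro e
    rcases hk.eq_or_lt with rfl | hk
    · exact serves_two hv V e
    · exact Serves.succ hv hanti hV hk ih (hbound _ e (by omega))

/-- With more bundles than surplus goods, the best goods can be handed out one by one. -/
lemma Serves.of_le (hv : ∀ i g, 0 ≤ v i g) (hanti : ∀ i, Antitone (v i)) {V : ℕ → ℕ} {e : ℕ}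
    (h : Serves v a V e e) {k : ℕ} (hk : e ≤ k) {G : Finset ℕ} {S : Finset ι}
    (hG : G.card = k + e) (hS : V e + e ≤ S.card) (hkS : k ≤ S.card)
    (hshare : ∀ i ∈ S, HasShare (v i) (a i) G k) :
    ∃ T ⊆ S, T.card = k ∧ Served v a T G := by
  induction k, hk using Nat.le_induction generalizing G with
  | base => exact h G S hG hS hshare
  | succ k hk ih =>
    have hne : G.Nonempty := card_pos.1 (by omega)
    -- The best good is set aside and its recipient chosen only after `T`, so the induction keeps
    -- all of `S` available.
    obtain ⟨T, hTS, hT, hserved⟩ := ih (G := G.erase (G.min' hne))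
      (by rw [card_erase_of_mem (G.min'_mem hne)]; omega) (by omega)
      fun i hi => (hshare i hi).erase (hv i) _
    obtain ⟨i, hi, hiT⟩ := exists_mem_notMem_of_card_lt_card (show T.card < S.card by omega)
    refine ⟨insert i T, insert_subset hi hTS, by rw [card_insert_of_notMem hiT, hT],
      Served.insert hv (B := {G.min' hne}) (by rwa [sdiff_singleton_eq_erase])
        (by simpa using G.min'_mem hne) hiT ?_⟩
    obtain ⟨f, hlt, hf⟩ := (hshare i hi).exists_lt (hv i)
    -- Since `e < k + 1`, there are fewer than `2 * (k + 1)` goods.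
    have hsmall : ∃ j < k + 1, (G.filter fun g => f g = j).card ≤ 1 := by
      by_contra! hcon
      have hsum : ∑ j ∈ range (k + 1), (G.filter fun g => f g = j).card = k + 1 + e := by
        rw [← hG]
        exact (card_eq_sum_card_fiberwise fun g _ => by simpa using hlt g).symm
      have := card_bundle_add_le hsum hcon (show 0 < k + 1 by omega)
      have := hcon 0 (by omega)
      omega
    obtain ⟨j, hj, hc⟩ := hsmall
    refine (hf j hj).trans ?_
    rw [sum_singleton]
    rcases Nat.le_one_iff_eq_zero_or_eq_one.1 hc with h0 | h1
    · rw [card_eq_zero.1 h0, sum_empty]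
      exact hv _ _
    · obtain ⟨g, hg⟩ := card_eq_one.1 h1
      rw [hg, sum_singleton]
      refine hanti i (G.min'_le g ?_)
      exact (mem_filter.1 (hg ▸ mem_singleton_self g :
        g ∈ G.filter fun g => f g = j)).1

end Core

/-! ### The recursive inequality for the number of spare agents -/

section Numeric

/-- The bound on the number of agents, before rounding. -/
noncomputable def target (e : ℕ) : ℝ := 0.6597 ^ e * (e.factorial : ℝ)

/-- The number of agents, beyond the number of bundles, that suffices with `e` surplus goods. -/
def spareAgents (e : ℕ) : ℕ :=
  -- These are the least values that the recursion permits at `k = 3`. The closed formula is larger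
  -- from `e = 5` on and, used there, would break the recursion at `e = 8`, `k = 3`. Integer
  -- arithmetic keeps everything computable by the kernel.
  if e < 9 then [0, 0, 0, 0, 0, 2, 20, 130, 772].getD e 0
  else 6597 ^ e * e.factorial / 10000 ^ e - e

lemma floor_target (e : ℕ) : ⌊target e⌋₊ = 6597 ^ e * e.factorial / 10000 ^ e := by
  rw [← Nat.floor_div_eq_div (K := ℝ), target]
  congr 1
  push_cast
  rw [show (0.6597 : ℝ) = 6597 / 10000 by norm_num, div_pow]
  ring

lemma target_succ (e : ℕ) : target (e + 1) = 0.6597 * (e + 1) * target e := by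
  rw [target, target, Nat.factorial_succ, pow_succ]
  push_cast
  ring

lemma target_pos (e : ℕ) : 0 < target e := by
  unfold target
  positivity

lemma le_target {e : ℕ} (he : 4 ≤ e) : (e : ℝ) ≤ target e := by
  induction e, he using Nat.le_induction with
  | base => norm_num [target, Nat.factorial]
  | succ e he ih =>
    rw [target_succ]
    have : (4 : ℝ) ≤ e := by exact_mod_cast he
    push_cast
    nlinarith

lemma spareAgents_of_le {e : ℕ} (he : 9 ≤ e) : spareAgents e = ⌊target e⌋₊ - e := by
  rw [spareAgents, if_neg (by omega), floor_target]

lemma spareAgents_add_le_target {e : ℕ} (he : 4 ≤ e) : (spareAgents e : ℝ) + e ≤ target e := by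
  rcases lt_or_ge e 9 with h | h
  · interval_cases e <;> norm_num [target, spareAgents, Nat.factorial]
  · have := le_target he
    rw [spareAgents_of_le h, Nat.cast_sub (Nat.le_floor this), sub_add_cancel]
    exact Nat.floor_le (target_pos e).le

lemma spareAgents_mono : Monotone spareAgents := by
  refine monotone_nat_of_le_succ fun e => ?_
  rcases lt_or_ge e 9 with h | h
  · interval_cases e <;> norm_num [spareAgents, Nat.factorial]
  · rw [spareAgents_of_le h, spareAgents_of_le (by omega)]
    have : ⌊target e⌋₊ + 1 ≤ ⌊target (e + 1)⌋₊ := by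
      rw [← Nat.floor_add_one (target_pos e).le, target_succ]
      refine Nat.floor_mono ?_
      have h9 : (9 : ℝ) ≤ e := by exact_mod_cast h
      nlinarith [le_target (e := e) (by omega)]
    omega

/-- `∑ i < s, c_i * (V (j - i) + d)`, where `c_i = n.choose (t + i)` and `c = c_0`. -/
def chooseSum (V : ℕ → ℕ) (n d : ℕ) : ℕ → ℕ → ℕ → ℕ → ℕ
  | 0, _, _, _ => 0
  | s + 1, t, c, j => c * (V j + d) + chooseSum V n d s (t + 1) (c * (n - t) / (t + 1)) (j - 1)

lemma chooseSum_eq (V : ℕ → ℕ) (n d s t j : ℕ) : chooseSum V n d s t (n.choose t) j =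
    ∑ i ∈ range s, n.choose (t + i) * (V (j - i) + d) := by
  induction s generalizing t j with
  | zero => rfl
  | succ s ih =>
    rw [chooseSum, sum_range_succ', ← Nat.choose_succ_right_eq,
      Nat.mul_div_cancel _ (Nat.succ_pos t), ih, add_comm]
    congr 1
    exact sum_congr rfl fun i _ => by
      rw [show t + 1 + i = t + (i + 1) by ring, show j - 1 - i = j - (i + 1) by omega]

lemma pairBound_eq (V : ℕ → ℕ) {k e : ℕ} : pairBound V k e =
    min (k - 1) (e - k) * (V (e - 1) + (k - 1)) +
      chooseSum V (k + e - 2) (k - 1) (e + 1 - 2 * k) 1 (k + e - 2) (e - 2) := by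
  have := chooseSum_eq V (k + e - 2) (k - 1) (e + 1 - 2 * k) 1 (e - 2)
  rw [Nat.choose_one_right] at this
  rw [this, pairBound, ← Finset.Ico_add_one_right_eq_Icc, sum_Ico_eq_sum_range]
  congr 1
  refine sum_congr (by simp) fun i _ => ?_
  rw [show e - 1 - (1 + i) = e - 2 - i by omega]

lemma worstBound_eq (V : ℕ → ℕ) {k e : ℕ} : worstBound V k e =
    chooseSum V (k + e - 2) (k - 1) (e - k + 1) 0 1 (e - 1) := by
  have := chooseSum_eq V (k + e - 2) (k - 1) (e - k + 1) 0 (e - 1)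
  rw [Nat.choose_zero_right] at this
  simp only [this, worstBound, zero_add]

-- A finite computation; `chooseSum` updates the binomial coefficients from term to term, which
-- keeps it cheap.
set_option maxRecDepth 10000 in
lemma bounds_of_lt_sixty : ∀ e < 60, ∀ k < e + 1, k < 3 ∨
    min (k - 1) (e - k) * (spareAgents (e - 1) + (k - 1)) +
      chooseSum spareAgents (k + e - 2) (k - 1) (e + 1 - 2 * k) 1 (k + e - 2) (e - 2)
        < spareAgents e + k ∨
    chooseSum spareAgents (k + e - 2) (k - 1) (e - k + 1) 0 1 (e - 1) < spareAgents e + k := by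
  decide +kernel

/-- Factor by factor, `2 * (k + e - 2 - t) ≤ 3 * (e - 1 - t)`. This is the source of the `1.5`
below. -/
lemma two_pow_mul_descFactorial_le {k e t : ℕ} (hk : 1 ≤ k) (ht : t + 2 * k ≤ e + 1) :
    2 ^ t * (k + e - 2).descFactorial t ≤ 3 ^ t * (e - 1).descFactorial t := by
  induction t with
  | zero => simp
  | succ t ih =>
    rw [Nat.descFactorial_succ, Nat.descFactorial_succ, pow_succ, pow_succ]
    calc 2 ^ t * 2 * ((k + e - 2 - t) * (k + e - 2).descFactorial t)
        = (2 * (k + e - 2 - t)) * (2 ^ t * (k + e - 2).descFactorial t) := by ring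
      _ ≤ (3 * (e - 1 - t)) * (3 ^ t * (e - 1).descFactorial t) :=
          Nat.mul_le_mul (by omega) (ih (by omega))
      _ = _ := by ring

lemma target_eq_descFactorial {n t : ℕ} (h : t ≤ n) :
    target n = 0.6597 ^ t * (n.descFactorial t : ℝ) * target (n - t) := by
  rw [target, target, ← Nat.factorial_mul_descFactorial h]
  nth_rw 1 [← Nat.sub_add_cancel h]
  rw [pow_add]
  push_cast
  ring

lemma choose_mul_target_le {k e t : ℕ} (hk : 1 ≤ k) (ht : t + 2 * k ≤ e + 1) :
    ((k + e - 2).choose t : ℝ) * target (e - 1 - t) ≤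
      target (e - 1) * ((1.5 / 0.6597) ^ t / (t.factorial : ℝ)) := by
  have h1 : (2 : ℝ) ^ t * ((t.factorial : ℝ) * (k + e - 2).choose t) ≤
      3 ^ t * (e - 1).descFactorial t := by
    rw [← Nat.cast_mul, ← Nat.descFactorial_eq_factorial_mul_choose]
    exact_mod_cast two_pow_mul_descFactorial_le hk ht
  rw [target_eq_descFactorial (show t ≤ e - 1 by omega), div_pow,
    show (1.5 : ℝ) = 3 / 2 by norm_num, div_pow]
  have hf : (0 : ℝ) < t.factorial := by positivity
  have h2 : ((k + e - 2).choose t : ℝ) ≤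
      3 ^ t / 2 ^ t * (e - 1).descFactorial t / t.factorial := by
    rw [le_div_iff₀ hf, div_mul_eq_mul_div, le_div_iff₀ (by positivity)]
    linarith
  calc _ ≤ 3 ^ t / 2 ^ t * ((e - 1).descFactorial t : ℝ) / t.factorial * target (e - 1 - t) :=
        mul_le_mul_of_nonneg_right h2 (target_pos _).le
    _ = _ := by field_simp

/-- The sum is part of the exponential series without its term `1` at `t = 0`, and `exp (1.5 /
0.6597) ≤ 10.2`. -/
lemma sum_pow_div_factorial_le (s : ℕ) :
    ∑ t ∈ Icc 1 s, (1.5 / 0.6597 : ℝ) ^ t / (t.factorial : ℝ) ≤ 9.2 := by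
  have h1 := Real.sum_le_exp_of_nonneg (x := 1.5 / 0.6597) (by norm_num) (s + 1)
  rw [range_eq_Ico, sum_eq_sum_Ico_succ_bot (Nat.succ_pos s), zero_add, Nat.succ_eq_add_one,
    Finset.Ico_add_one_right_eq_Icc] at h1
  have h2 : Real.exp (1.5 / 0.6597) ≤ 10.2 := by
    have h3 : Real.exp (1.5 / 0.6597) ≤ Real.exp 1 * Real.exp 1 * Real.exp 0.274 := by
      rw [← Real.exp_add, ← Real.exp_add]
      exact Real.exp_le_exp.2 (by norm_num)
    have h4 : Real.exp 0.274 ≤ 1.3775 := by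
      have h5 := Real.add_one_le_exp (-0.274 : ℝ)
      have h6 : Real.exp 0.274 * Real.exp (-0.274) = 1 := by rw [← Real.exp_add]; norm_num
      nlinarith [Real.exp_pos 0.274]
    have h7 := Real.exp_one_lt_d9
    have h8 := Real.exp_pos 1
    calc _ ≤ _ := h3
      _ ≤ 2.7183 * 2.7183 * 1.3775 := by gcongr <;> linarith
      _ ≤ _ := by norm_num
  simp only [pow_zero, Nat.factorial_zero, Nat.cast_one, div_one] at h1
  linarith

/-- After division by `target (e - 1)`, the pairs contribute about `e / 2` at most and the larger
bundles at most a constant, whereas `target e` contributes `0.6597 * e`. -/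
lemma pairBound_lt {k e : ℕ} (hk : 3 ≤ k) (hke : k ≤ e) (he : 60 ≤ e) :
    pairBound spareAgents k e < spareAgents e + k := by
  have hV : ∀ j, 2 * k - 2 ≤ j → ((spareAgents j + (k - 1) : ℕ) : ℝ) ≤ target j := by
    intro j hj
    have h1 : ((k - 1 : ℕ) : ℝ) ≤ j := by exact_mod_cast (show k - 1 ≤ j by omega)
    have := spareAgents_add_le_target (show 4 ≤ j by omega)
    push_cast
    linarith
  have hV1 : ((spareAgents (e - 1) + (k - 1) : ℕ) : ℝ) ≤ target (e - 1) := by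
    have h1 : ((k - 1 : ℕ) : ℝ) ≤ ((e - 1 : ℕ) : ℝ) := by exact_mod_cast (show k - 1 ≤ e - 1 by omega)
    have := spareAgents_add_le_target (show 4 ≤ e - 1 by omega)
    push_cast
    linarith
  have hpos := target_pos (e - 1)
  have hsum : ∑ t ∈ Icc 1 (e + 1 - 2 * k), ((k + e - 2).choose t : ℝ) *
      ((spareAgents (e - 1 - t) + (k - 1) : ℕ) : ℝ) ≤ target (e - 1) *
        ∑ t ∈ Icc 1 (e + 1 - 2 * k), (1.5 / 0.6597 : ℝ) ^ t / (t.factorial : ℝ) := by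
    rw [mul_sum]
    refine sum_le_sum fun t ht => ?_
    rw [mem_Icc] at ht
    exact (mul_le_mul_of_nonneg_left (hV _ (by omega)) (Nat.cast_nonneg _)).trans
      (choose_mul_target_le (by omega) (by omega))
  -- For `e < 2 * k` the sum is empty; otherwise `k - 1 ≤ e / 2 - 1`, and the sum is at most `9.2`.
  have hmain : ((min (k - 1) (e - k) : ℕ) : ℝ) +
      ∑ t ∈ Icc 1 (e + 1 - 2 * k), (1.5 / 0.6597 : ℝ) ^ t / (t.factorial : ℝ) ≤ e / 2 + 8.2 := by
    rcases lt_or_ge e (2 * k) with h | h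
    · have h1 : ((2 * min (k - 1) (e - k) : ℕ) : ℝ) ≤ e := by
        exact_mod_cast (show 2 * min (k - 1) (e - k) ≤ e by omega)
      rw [show e + 1 - 2 * k = 0 by omega]
      push_cast at h1 ⊢
      simp only [zero_lt_one, Icc_eq_empty_of_lt, sum_empty]
      linarith
    · have h1 : ((2 * min (k - 1) (e - k) + 2 : ℕ) : ℝ) ≤ e := by
        exact_mod_cast (show 2 * min (k - 1) (e - k) + 2 ≤ e by omega)
      have := sum_pow_div_factorial_le (e + 1 - 2 * k)
      push_cast at h1 ⊢
      linarith
  have he' : (60 : ℝ) ≤ e := by exact_mod_cast he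
  have hsucc : target e = 0.6597 * e * target (e - 1) := by
    have := target_succ (e - 1)
    rw [Nat.sub_add_cancel (by omega)] at this
    rw [this, Nat.cast_sub (by omega)]
    simp
  have hlarge : (e : ℝ) - 1 ≤ target (e - 1) := by
    have := le_target (show 4 ≤ e - 1 by omega)
    rwa [Nat.cast_sub (by omega), Nat.cast_one] at this
  have hVe : target e - e - 1 < spareAgents e := by
    have h1 := Nat.lt_floor_add_one (target e)
    rw [spareAgents_of_le (by omega),
      Nat.cast_sub (Nat.le_floor (le_target (by omega)))]
    linarith
  have hfinal : (pairBound spareAgents k e : ℝ) < spareAgents e + k := by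
    have h3 : (3 : ℝ) ≤ k := by exact_mod_cast hk
    calc (pairBound spareAgents k e : ℝ)
        = ((min (k - 1) (e - k) : ℕ) : ℝ) * ((spareAgents (e - 1) + (k - 1) : ℕ) : ℝ) +
          ∑ t ∈ Icc 1 (e + 1 - 2 * k), ((k + e - 2).choose t : ℝ) *
            ((spareAgents (e - 1 - t) + (k - 1) : ℕ) : ℝ) := by
          rw [pairBound, Nat.cast_add, Nat.cast_mul, Nat.cast_sum]
          simp only [Nat.cast_mul]
      _ ≤ target (e - 1) * (e / 2 + 8.2) := by
          have := mul_le_mul_of_nonneg_left hV1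
            (Nat.cast_nonneg (α := ℝ) (min (k - 1) (e - k)))
          have := mul_le_mul_of_nonneg_left hmain hpos.le
          linarith
      -- For `e ≥ 60` the gap `0.1597 * e - 8.2` exceeds `1`, and `target (e - 1) ≥ e - 1`.
      _ ≤ target e - e + 2 := by
          rw [hsucc]
          nlinarith
      _ < _ := by linarith
  exact_mod_cast hfinal

lemma pairBound_or_worstBound_lt (k e : ℕ) (hk : 3 ≤ k) (hke : k ≤ e) :
    pairBound spareAgents k e < spareAgents e + k ∨
      worstBound spareAgents k e < spareAgents e + k := by
  rcases lt_or_ge e 60 with he | he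
  · rw [pairBound_eq, worstBound_eq]
    exact (bounds_of_lt_sixty e he k (by omega)).resolve_left (by omega)
  · exact Or.inl (pairBound_lt hk hke he)

end Numeric

/-! ### Reduction to agents with a common ranking of the goods -/

section Ordered

variable {n m : ℕ}

/-- The ranking of the goods by agent `i`, from best to worst. -/
noncomputable def ranking (I : GoodsInstance (Fin n) (Fin m)) (i : Fin n) : Equiv.Perm (Fin m) :=
  Tuple.sort fun g => -I.v i {g}

/-- The value for agent `i` of her `r`-th best good. -/
noncomputable def rankedValue (I : GoodsInstance (Fin n) (Fin m)) (i : Fin n) (r : ℕ) : ℝ :=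
  if h : r < m then I.v i {ranking I i ⟨r, h⟩} else 0

variable (I : GoodsInstance (Fin n) (Fin m))

lemma rankedValue_val (i : Fin n) (r : Fin m) :
    rankedValue I i r = I.v i {ranking I i r} := by
  simp [rankedValue]

lemma rankedValue_nonneg (i : Fin n) (r : ℕ) : 0 ≤ rankedValue I i r := by
  unfold rankedValue
  split_ifs
  · exact I.nonneg _ _
  · exact le_rfl

lemma rankedValue_antitone (i : Fin n) : Antitone (rankedValue I i) := by
  intro r s hrs
  by_cases hs : s < m
  · have hr : r < m := by omega
    rw [rankedValue, rankedValue, dif_pos hs, dif_pos hr]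
    have := Tuple.monotone_sort (fun g => -I.v i {g}) (show (⟨r, hr⟩ : Fin m) ≤ ⟨s, hs⟩ from hrs)
    exact neg_le_neg_iff.1 this
  · rw [rankedValue, dif_neg hs]
    exact rankedValue_nonneg I i r

/-- Ranks from `m` on are dummy goods of value zero, so an instance with at most `n + c` goods can
be treated as having exactly `n + c`. -/
lemma hasShare_rankedValue [NeZero n] {l : ℕ} (hl : m ≤ l) (i : Fin n) :
    HasShare (rankedValue I i) (I.mms i) (range l) n := by
  obtain ⟨A, -, hA⟩ := exists_mem_eq_sup' (univ_nonempty (α := Allocation (Fin n) (Fin m)))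
    fun A => (univ : Finset (Fin n)).inf' univ_nonempty fun j => I.v i (A.bundle j)
  refine ⟨fun r => if h : r < m then A (ranking I i ⟨r, h⟩) else 0, fun j hj => ?_⟩
  have h1 : I.mms i ≤ I.v i (A.bundle ⟨j, hj⟩) :=
    hA.le.trans (inf'_le _ (mem_univ (⟨j, hj⟩ : Fin n)))
  have hinj : Function.Injective fun g => ((ranking I i).symm g : ℕ) :=
    Fin.val_injective.comp (ranking I i).symm.injective
  have h2 : I.v i (A.bundle ⟨j, hj⟩) =
      ∑ r ∈ (A.bundle ⟨j, hj⟩).image fun g => ((ranking I i).symm g : ℕ), rankedValue I i r := by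
    rw [I.additive, sum_image hinj.injOn]
    exact sum_congr rfl fun g _ => by rw [rankedValue_val, Equiv.apply_symm_apply]
  rw [h2] at h1
  refine h1.trans (sum_le_sum_of_subset_of_nonneg (fun r hr => ?_)
    fun r _ _ => rankedValue_nonneg I i r)
  obtain ⟨g, hg, rfl⟩ := mem_image.1 hr
  have hlt := ((ranking I i).symm g).isLt
  have hgA : A g = ⟨j, hj⟩ := (mem_filter.1 hg).2
  simp only [mem_filter, mem_range, hlt, dif_pos, Fin.eta, Equiv.apply_symm_apply, hgA, and_true]
  omega

/-- When the agents pick in turn, the agent whose turn is `r` can get a good at least as valuable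
to her as her `r`-th best good. -/
lemma exists_picking (a : Fin m → Fin n) :
    ∃ p : Equiv.Perm (Fin m), ∀ r, rankedValue I (a r) r ≤ I.v (a r) {p r} := by
  classical
  let t : Fin m → Finset (Fin m) := fun r =>
    univ.filter fun g => rankedValue I (a r) r ≤ I.v (a r) {g}
  have hall : ∀ X : Finset (Fin m), X.card ≤ (X.biUnion t).card := by
    intro X
    rcases X.eq_empty_or_nonempty with rfl | hX
    · simp
    -- Hall's condition: the agent with the last turn in `X` accepts every good she ranks up to that
    -- turn, and these are at least as many as the turns in `X`.
    have hsub : (Iic (X.max' hX)).map (ranking I (a (X.max' hX))).toEmbedding ⊆ X.biUnion t := by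
      intro g hg
      obtain ⟨s, hs, rfl⟩ := mem_map.1 hg
      refine mem_biUnion.2 ⟨_, X.max'_mem hX, mem_filter.2 ⟨mem_univ _, ?_⟩⟩
      have := rankedValue_antitone I (a (X.max' hX)) (Fin.le_def.1 (mem_Iic.1 hs))
      rwa [rankedValue_val I _ s] at this
    calc X.card ≤ (Iic (X.max' hX)).card :=
          card_le_card fun r hr => mem_Iic.2 (X.le_max' r hr)
      _ ≤ _ := by
          rw [← card_map (ranking I (a (X.max' hX))).toEmbedding]
          exact card_le_card hsub
  obtain ⟨p, hp, hpt⟩ := (all_card_le_biUnion_card_iff_exists_injective t).1 hall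
  exact ⟨Equiv.ofBijective p (Finite.injective_iff_bijective.1 hp),
    fun r => (mem_filter.1 (hpt r)).2⟩

/-- It suffices to serve the agents when they all rank the goods in the same order. -/
lemma exists_isMMSAllocation_of_served [NeZero n] {l : ℕ}
    (h : Served (rankedValue I) I.mms univ (range l)) :
    ∃ A : Allocation (Fin n) (Fin m), I.IsMMSAllocation A := by
  obtain ⟨F, hF⟩ := h
  obtain ⟨p, hp⟩ := exists_picking I fun r => F r
  refine ⟨fun g => F (p.symm g), fun i => (hF i (mem_univ i)).trans ?_⟩
  have hsub : ∑ r ∈ range l with F r = i, rankedValue I i r ≤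
      ∑ r ∈ (univ.filter fun r : Fin m => F r = i).map Fin.valEmbedding, rankedValue I i r := by
    -- Dummy goods have value zero and drop out.
    rw [← sum_filter_ne_zero]
    refine sum_le_sum_of_subset_of_nonneg (fun r hr => ?_) fun r _ _ => rankedValue_nonneg I i r
    obtain ⟨hr, h0⟩ := mem_filter.1 hr
    have hrm : r < m := by
      by_contra h
      exact h0 (by rw [rankedValue, dif_neg h])
    exact mem_map.2 ⟨⟨r, hrm⟩, by simpa using (mem_filter.1 hr).2, rfl⟩
  refine hsub.trans ?_
  have hbundle : Allocation.bundle (fun g => F (p.symm g)) i =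
      (univ.filter fun r : Fin m => F r = i).map p.toEmbedding := by
    ext g
    simp [Allocation.bundle]
  rw [I.additive, hbundle, sum_map, sum_map]
  refine sum_le_sum fun r hr => ?_
  have hri : F r = i := (mem_filter.1 hr).2
  simpa [hri] using hp r

end Ordered

end MaximinShare

/-! ### Serving all agents without spares -/

theorem theorem1 (c : ℕ) (hc : 0 < c) :
    ∃ n_c : ℕ, n_c ≤ ⌊(0.6597 : ℝ) ^ c * (Nat.factorial c : ℝ)⌋₊ ∧
      ∀ (n m : ℕ) [NeZero n], n_c ≤ n → m ≤ n + c →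
        ∀ I : GoodsInstance (Fin n) (Fin m),
          ∃ A : Allocation (Fin n) (Fin m), I.IsMMSAllocation A := by
  open MaximinShare in
  refine ⟨_, le_rfl, fun n m _ hn hm I => ?_⟩
  have hn0 : 1 ≤ n := NeZero.one_le
  have hS : ∀ k, 1 ≤ k → ∀ e, Serves (rankedValue I) I.mms spareAgents k e := fun k hk =>
    serves (rankedValue_nonneg I) (rankedValue_antitone I) spareAgents_mono
      pairBound_or_worstBound_lt hk
  have hshare : ∀ i ∈ (Finset.univ : Finset (Fin n)),
      HasShare (rankedValue I i) (I.mms i) (Finset.range (n + c)) n :=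
    fun i _ => hasShare_rankedValue I hm i
  obtain ⟨T, -, hT, hserved⟩ : ∃ T ⊆ (Finset.univ : Finset (Fin n)), T.card = n ∧
      Served (rankedValue I) I.mms T (Finset.range (n + c)) := by
    rcases le_or_gt c 4 with h4 | h4
    · have h0 : spareAgents c = 0 := by interval_cases c <;> rfl
      exact hS n hn0 c _ _ (Finset.card_range _) (by simp [h0]) hshare
    -- The bound on `n` pays for the spare agents at the stage with `c` bundles left.
    · have hcn : spareAgents c + c ≤ n :=
        (Nat.le_floor (by exact_mod_cast spareAgents_add_le_target h4.le)).trans hn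
      exact (hS c hc c).of_le (rankedValue_nonneg I) (rankedValue_antitone I) (by omega)
        (Finset.card_range _) (by simpa using hcn) (by simp) hshare
  rw [(Finset.card_eq_iff_eq_univ T).1 (by simpa using hT)] at hserved
  exact exists_isMMSAllocation_of_served I hserved
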